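/- Let $q$ be a positive integer, $n_1,\dots,n_q\ge 1$ integers, $n=\sum_i n_i$, and let $n\times n$ real matrices be partitioned into blocks $M_{ij}\in\mathbb R^{n_i\times n_j}$. Let $G_{\mathcal P}$ and $G_{\mathcal K}$ be directed graphs on $\{1,\dots,q\}$ (self-loops allowed) with every edge of $G_{\mathcal P}$ an edge of $G_{\mathcal K}$, and let $\epsilon>0$. Let $\mathcal A$ (resp. $\mathcal K$) be the set of $n\times n$ real matrices $M$ with $M_{ij}=0$ whenever $(j,i)$ is not an edge of $G_{\mathcal P}$ (resp. $G_{\mathcal K}$). Let $\mathcal B$ be either the set of block-diagonal matrices $B\in\mathbb R^{n\times n}$ ($B_{ij}=0$ for $i\ne j$) with smallest singular value at least $\epsilon$, or the set of diagonal matrices with all diagonal entries at least $\epsilon$. A plant is a triple $P=(A,B,x_0)\in\mathcal A\times\mathcal B\times\mathbb R^n$, and for $K\in\mathcal K$ its cost is $$J_P(K)=\sum_{k=1}^\infty x(k)^Tx(k)+\sum_{k=0}^\infty u(k)^Tu(k)\in[0,\infty],\qquad x(k+1)=Ax(k)+Bu(k),\ u(k)=Kx(k),\ x(0)=x_0 .$$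 A communication-less design method is a map $\Gamma:\mathcal A\times\mathcal B\to\mathcal K$ such that, for every $i$, the block row $[\Gamma_{i1}(A,B)\ \cdots\ \Gamma_{iq}(A,B)]$ is a function only of $[A_{i1}\ \cdots\ A_{iq}]$ and $B_{ii}$. A design method $\Gamma$ dominates $\Gamma'$ if $J_P(\Gamma(A,B))\le J_P(\Gamma'(A,B))$ for all plants $P=(A,B,x_0)$, with strict inequality for at least one plant. A node $i$ is a sink if $G_{\mathcal P}$ has no edge $(i,j)$ with $j\neq i$; it is isolated if $G_{\mathcal P}$ has no edge $(i,j)$ or $(j,i)$ with $j\ne i$. Assume that $G_{\mathcal P}$ has no isolated node and at least one sink. Then for every $(A,B)\in\mathcal A\times\mathcal B$ and every sink $i$ the discrete algebraic Riccati equation $$A_{ii}^TX_{ii}B_{ii}(I+B_{ii}^TX_{ii}B_{ii})^{-1}B_{ii}^TX_{ii}A_{ii}-A_{ii}^TX_{ii}A_{ii}+X_{ii}-I=0$$ has a unique positive definite solution $X_{ii}$. Put $\Gamma^\Theta(A,B)=-\mathrm{diag}(D_1,\dots,D_q)\,A$, where $D_i=(I+B_{ii}^TX_{ii}B_{ii})^{-1}B_{ii}^TX_{ii}$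 if $i$ is a sink and $D_i=B_{ii}^{-1}$ otherwise. Then $\Gamma^\Theta$ is a communication-less design method, and no communication-less design method dominates it. -/

import Mathlib

open scoped Matrix

noncomputable section

namespace LimitedModel

variable {q : ℕ}

/-- A node is a sink if it has no edge to another node (a self-loop is allowed). -/
def IsSink (G : Digraph (Fin q)) (i : Fin q) : Prop :=
  ∀ j, j ≠ i → ¬ G.Adj i j

/-- A node is isolated if no edge joins it to another node (a self-loop is allowed). -/
def IsIsolated (G : Digraph (Fin q)) (i : Fin q) : Prop :=
  ∀ j, j ≠ i → ¬ G.Adj i j ∧ ¬ G.Adj j i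

/-- The totally disconnected graph with self-loops. A design graph of this form makes
design methods communication-less. -/
def selfLoopGraph (q : ℕ) : Digraph (Fin q) where
  Adj i j := i = j

/-- State (and input) indices: the pair `⟨i, a⟩` is the `a`-th coordinate of subsystem `i`,
which has dimension `n i`. -/
abbrev StateIdx (n : Fin q → ℕ) : Type := Σ i : Fin q, Fin (n i)

/-- `n × n` real matrices, where `n = ∑ i, n i`, with rows and columns grouped by subsystem. -/
abbrev SysMatrix (n : Fin q → ℕ) : Type := Matrix (StateIdx n) (StateIdx n) ℝ

/-- The block `M_{ij}`, of size `n i × n j`. -/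
def block {n : Fin q → ℕ} (M : SysMatrix n) (i j : Fin q) :
    Matrix (Fin (n i)) (Fin (n j)) ℝ :=
  Matrix.of fun a b => M ⟨i, a⟩ ⟨j, b⟩

/-- The block row `[M_{i1} ⋯ M_{iq}]`. -/
def blockRow {n : Fin q → ℕ} (M : SysMatrix n) (i : Fin q) :
    Matrix (Fin (n i)) (StateIdx n) ℝ :=
  Matrix.of fun a l => M ⟨i, a⟩ l

/-- Matrices whose block `(i, j)` vanishes unless `(j, i)` is an edge of `G`. For the plant graph
this is the set of state matrices, for the control graph it is the set of controllers. -/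
def structuredMatrices (n : Fin q → ℕ) (G : Digraph (Fin q)) : Set (SysMatrix n) :=
  {M | ∀ i j, ¬ G.Adj j i → block M i j = 0}

/-- The smallest singular value of a square matrix. Mathlib lists the singular values in
decreasing order, starting at index `0`, so it is the one whose index is the size minus one. -/
def minSingularValue {n : Fin q → ℕ} (M : SysMatrix n) : ℝ :=
  (Matrix.toEuclideanLin M).singularValues (Fintype.card (StateIdx n) - 1)

/-- Block-diagonal input matrices with smallest singular value at least `ε`. -/
def inputMatrices (n : Fin q → ℕ) (ε : ℝ) : Set (SysMatrix n) :=
  {B | ε ≤ minSingularValue B ∧ ∀ i j, i ≠ j → block B i j = 0}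

/-- Diagonal input matrices with diagonal entries at least `ε`. -/
def diagInputMatrices (n : Fin q → ℕ) (ε : ℝ) : Set (SysMatrix n) :=
  {B | B.IsDiag ∧ ∀ l, ε ≤ B l l}

/-- The state `x(k)` of `x(k+1) = A x(k) + B u(k)`, `u(k) = K x(k)`, `x(0) = x₀`. -/
def trajectory {n : Fin q → ℕ} (A B K : SysMatrix n) (x₀ : StateIdx n → ℝ) :
    ℕ → StateIdx n → ℝ
  | 0 => x₀
  | k + 1 => A *ᵥ trajectory A B K x₀ k + B *ᵥ (K *ᵥ trajectory A B K x₀ k)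

/-- The closed-loop cost `∑_{k ≥ 1} x(k)ᵀ x(k) + ∑_{k ≥ 0} u(k)ᵀ u(k)`, with values in `[0, ∞]`. -/
def cost {n : Fin q → ℕ} (A B : SysMatrix n) (x₀ : StateIdx n → ℝ) (K : SysMatrix n) : ENNReal :=
  (∑' k : ℕ, ENNReal.ofReal
      (trajectory A B K x₀ (k + 1) ⬝ᵥ trajectory A B K x₀ (k + 1))) +
    ∑' k : ℕ, ENNReal.ofReal
      ((K *ᵥ trajectory A B K x₀ k) ⬝ᵥ (K *ᵥ trajectory A B K x₀ k))

/-- Control design methods with structure `GC`: maps from plants `(A, B)` (only the values on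
plants matter) to controllers, such that the `i`-th block row of the controller is a function of
those `[A_{j1} ⋯ A_{jq}]` and `B_{jj}` for which `(j, i)` is an edge of `GC`. -/
def designMethods (n : Fin q → ℕ) (GP GK GC : Digraph (Fin q)) (𝓑 : Set (SysMatrix n)) :
    Set (SysMatrix n → SysMatrix n → SysMatrix n) :=
  {Γ | (∀ A ∈ structuredMatrices n GP, ∀ B ∈ 𝓑, Γ A B ∈ structuredMatrices n GK) ∧
    ∀ i, ∀ A ∈ structuredMatrices n GP, ∀ A' ∈ structuredMatrices n GP, ∀ B ∈ 𝓑, ∀ B' ∈ 𝓑,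
      (∀ j, GC.Adj j i → blockRow A j = blockRow A' j ∧ block B j j = block B' j j) →
        blockRow (Γ A B) i = blockRow (Γ A' B') i}

/-- `Γ` dominates `Γ'`: its cost is at most that of `Γ'` on every plant `(A, B, x₀)`, and strictly
smaller on at least one plant. -/
def Dominates (n : Fin q → ℕ) (GP : Digraph (Fin q)) (𝓑 : Set (SysMatrix n))
    (Γ Γ' : SysMatrix n → SysMatrix n → SysMatrix n) : Prop :=
  (∀ A ∈ structuredMatrices n GP, ∀ B ∈ 𝓑, ∀ x₀ : StateIdx n → ℝ,
      cost A B x₀ (Γ A B) ≤ cost A B x₀ (Γ' A B)) ∧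
    ∃ A ∈ structuredMatrices n GP, ∃ B ∈ 𝓑, ∃ x₀ : StateIdx n → ℝ,
      cost A B x₀ (Γ A B) < cost A B x₀ (Γ' A B)

/-- `Γ'` has structure `GC` and no design method with structure `GC` dominates it. -/
def IsUndominated (n : Fin q → ℕ) (GP GK GC : Digraph (Fin q)) (𝓑 : Set (SysMatrix n))
    (Γ' : SysMatrix n → SysMatrix n → SysMatrix n) : Prop :=
  Γ' ∈ designMethods n GP GK GC 𝓑 ∧
    ∀ Γ ∈ designMethods n GP GK GC 𝓑, ¬ Dominates n GP 𝓑 Γ Γ'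

/-- `X` is a positive definite solution of the discrete algebraic Riccati equation of `(A, B)`
with identity weights. -/
def IsRiccatiSolution {m : ℕ} (A B X : Matrix (Fin m) (Fin m) ℝ) : Prop :=
  X.PosDef ∧
    Aᵀ * X * B * (1 + Bᵀ * X * B)⁻¹ * Bᵀ * X * A - Aᵀ * X * A + X - 1 = 0

open Classical in
/-- The positive definite solution of the Riccati equation. -/
def riccatiSolution {m : ℕ} (A B : Matrix (Fin m) (Fin m) ℝ) : Matrix (Fin m) (Fin m) ℝ :=
  if h : ∃ X, IsRiccatiSolution A B X then h.choose else 0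

/-- `W = (I + Bᵀ X B)⁻¹ Bᵀ X`, where `X` is the positive definite Riccati solution. -/
def lqrFactor {m : ℕ} (A B : Matrix (Fin m) (Fin m) ℝ) : Matrix (Fin m) (Fin m) ℝ :=
  (1 + Bᵀ * riccatiSolution A B * B)⁻¹ * Bᵀ * riccatiSolution A B

open Classical in
/-- The design method `Γ^Θ(A, B) = - diag(D_1, …, D_q) A`, where `D_i = B_{ii}⁻¹` if `i` is not a
sink of the plant graph and `D_i = W_i(A, B)`, computed from `A_{ii}` and `B_{ii}`, if it is. -/
def gammaTheta (n : Fin q → ℕ) (GP : Digraph (Fin q)) (A B : SysMatrix n) : SysMatrix n :=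
  -(Matrix.blockDiagonal' (fun i =>
      if IsSink GP i then lqrFactor (block A i i) (block B i i) else (block B i i)⁻¹) * A)

end LimitedModel

end

/-! Suppose a communication-less `Γ` never costs more than `gammaTheta`. The claim is that `Γ` then
never costs less either.

The key point is that `Γ` must cancel the drift of every nonsink `i` in one step
(`isDeadbeatOnNonsinks_of_cost_le`). Block row `i` of the controller sees only block row `i` of `A`
and `B_ii`, so the rest of the plant may be changed adversarially. Choose an edge `i → l`, let `A`
have a single entry `r` outside row `i`, feeding a coordinate of `i` into `l`, and set `B_ll = b I`.
A residual state left at `i` after one step then costs a multiple of `r ^ 2` in `l`, while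
`gammaTheta` pays for the initial state only; suitable large `b` and `r` give a contradiction.

Once the nonsinks vanish from time 1 on, no sink receives anything from another node, so each sink
faces its own LQR problem, started from the drift `(A x₀)_i`. The Riccati feedback solves that
problem optimally, and each nonsink pays at least its first input. Hence `gammaTheta` is at least as
good as `Γ` on every plant (`cost_gammaTheta_le_of_isDeadbeatOnNonsinks`).

The Riccati theory rests on a completed square (`riccati_complete_square`): existence by value
iteration, uniqueness because the solution is determined by the optimal cost. -/

noncomputable section

namespace LimitedModel

/-! ### The Riccati equation and the LQR problem with invertible input matrix -/

section Riccati

open Filter Topology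

variable {ι : Type*}

theorem posSemidef_transpose_eq {X : Matrix ι ι ℝ} (hX : X.PosSemidef) : Xᵀ = X := by
  simpa using hX.isHermitian.eq

variable [Fintype ι]

theorem dotProduct_mulVec_comm_of_isSymm {X : Matrix ι ι ℝ} (hX : Xᵀ = X) (a b : ι → ℝ) :
    a ⬝ᵥ (X *ᵥ b) = b ⬝ᵥ (X *ᵥ a) := by
  rw [Matrix.dotProduct_mulVec, ← Matrix.mulVec_transpose, hX, dotProduct_comm]

theorem dotProduct_transpose_mulVec' (B : Matrix ι ι ℝ) (a b : ι → ℝ) :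
    a ⬝ᵥ (Bᵀ *ᵥ b) = (B *ᵥ a) ⬝ᵥ b := by
  rw [Matrix.dotProduct_mulVec, Matrix.vecMul_transpose]

theorem posSemidef_dotProduct_nonneg {X : Matrix ι ι ℝ} (hX : X.PosSemidef) (x : ι → ℝ) :
    0 ≤ x ⬝ᵥ (X *ᵥ x) := by
  simpa using hX.dotProduct_mulVec_nonneg x

theorem dotProduct_self_nonneg' (u : ι → ℝ) : 0 ≤ u ⬝ᵥ u := by
  simpa using dotProduct_star_self_nonneg u

/-- Polarization transfers equality and convergence from quadratic forms to matrix entries. -/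
theorem dotProduct_mulVec_polarization [DecidableEq ι] {X : Matrix ι ι ℝ} (hX : Xᵀ = X) (i j : ι) :
    X i j = ((Pi.single i 1 + Pi.single j 1) ⬝ᵥ (X *ᵥ (Pi.single i 1 + Pi.single j 1)) -
      Pi.single i 1 ⬝ᵥ (X *ᵥ Pi.single i 1) - Pi.single j 1 ⬝ᵥ (X *ᵥ Pi.single j 1)) / 2 := by
  have h : X j i = X i j := by conv_lhs => rw [← hX, Matrix.transpose_apply]
  simp [Matrix.mulVec_add, add_dotProduct, h]
  ring

theorem eq_of_dotProduct_mulVec_eq {X Y : Matrix ι ι ℝ} (hX : Xᵀ = X) (hY : Yᵀ = Y)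
    (h : ∀ x, x ⬝ᵥ (X *ᵥ x) = x ⬝ᵥ (Y *ᵥ x)) : X = Y := by
  classical
  ext i j
  rw [dotProduct_mulVec_polarization hX, dotProduct_mulVec_polarization hY, h, h, h]

variable [DecidableEq ι]

/-- The Schur-type correction `X - X B (1 + Bᵀ X B)⁻¹ Bᵀ X`; its quadratic form at `y` is the least
value of `uᵀ u + (y + B u)ᵀ X (y + B u)`. -/
def riccatiReduction (B X : Matrix ι ι ℝ) : Matrix ι ι ℝ :=
  X - X * B * (1 + Bᵀ * X * B)⁻¹ * Bᵀ * X

theorem posDef_one_add_conj {X : Matrix ι ι ℝ} (hX : X.PosSemidef) (B : Matrix ι ι ℝ) :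
    (1 + Bᵀ * X * B).PosDef := by
  have h := hX.conjTranspose_mul_mul_same B
  rw [Matrix.conjTranspose_eq_transpose_of_trivial] at h
  exact Matrix.PosDef.one.add_posSemidef h

/-- With `S = 1 + Bᵀ X B` and `w = S⁻¹ Bᵀ X y`, the identity `S w = Bᵀ X y` makes the cross terms
agree. The minimising input is therefore `-w`. -/
theorem riccati_complete_square {X : Matrix ι ι ℝ} (hX : X.PosSemidef) (B : Matrix ι ι ℝ)
    (u y : ι → ℝ) :
    u ⬝ᵥ u + (y + B *ᵥ u) ⬝ᵥ (X *ᵥ (y + B *ᵥ u)) =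
      (u + ((1 + Bᵀ * X * B)⁻¹ * Bᵀ * X) *ᵥ y) ⬝ᵥ
        ((1 + Bᵀ * X * B) *ᵥ (u + ((1 + Bᵀ * X * B)⁻¹ * Bᵀ * X) *ᵥ y)) +
      y ⬝ᵥ (riccatiReduction B X *ᵥ y) := by
  have hXt := posSemidef_transpose_eq hX
  have hS := posDef_one_add_conj hX B
  have hSu : IsUnit (1 + Bᵀ * X * B).det := (Matrix.isUnit_iff_isUnit_det _).1 hS.isUnit
  have hN : riccatiReduction B X *ᵥ y =
      X *ᵥ y - X *ᵥ (B *ᵥ (((1 + Bᵀ * X * B)⁻¹ * Bᵀ * X) *ᵥ y)) := by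
    simp [riccatiReduction, Matrix.sub_mulVec, Matrix.mulVec_mulVec, Matrix.mul_assoc]
  have hSw : (1 + Bᵀ * X * B) *ᵥ (((1 + Bᵀ * X * B)⁻¹ * Bᵀ * X) *ᵥ y) = Bᵀ *ᵥ (X *ᵥ y) := by
    rw [Matrix.mulVec_mulVec, Matrix.mulVec_mulVec, Matrix.mul_assoc _ Bᵀ X,
      Matrix.mul_nonsing_inv_cancel_left _ _ hSu]
  have hSsymm : (1 + Bᵀ * X * B)ᵀ = 1 + Bᵀ * X * B := posSemidef_transpose_eq hS.posSemidef
  rw [hN]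
  generalize hw : ((1 + Bᵀ * X * B)⁻¹ * Bᵀ * X) *ᵥ y = w at *
  rw [Matrix.mulVec_add _ u w, hSw, dotProduct_add, add_dotProduct, add_dotProduct,
    dotProduct_mulVec_comm_of_isSymm hSsymm w u, hSw, dotProduct_transpose_mulVec',
    dotProduct_transpose_mulVec', Matrix.add_mulVec, Matrix.one_mulVec, ← Matrix.mulVec_mulVec,
    ← Matrix.mulVec_mulVec, dotProduct_add, dotProduct_transpose_mulVec']
  simp only [Matrix.mulVec_add, dotProduct_add, add_dotProduct, dotProduct_sub]
  rw [dotProduct_mulVec_comm_of_isSymm hXt (B *ᵥ u) y,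
    dotProduct_mulVec_comm_of_isSymm hXt (B *ᵥ w) y]
  ring

theorem riccatiReduction_le {X : Matrix ι ι ℝ} (hX : X.PosSemidef) (B : Matrix ι ι ℝ)
    (u y : ι → ℝ) :
    y ⬝ᵥ (riccatiReduction B X *ᵥ y) ≤ u ⬝ᵥ u + (y + B *ᵥ u) ⬝ᵥ (X *ᵥ (y + B *ᵥ u)) := by
  rw [riccati_complete_square hX]
  linarith [posSemidef_dotProduct_nonneg (posDef_one_add_conj hX B).posSemidef
    (u + ((1 + Bᵀ * X * B)⁻¹ * Bᵀ * X) *ᵥ y)]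

theorem riccatiReduction_eq {X : Matrix ι ι ℝ} (hX : X.PosSemidef) (B : Matrix ι ι ℝ)
    {u y : ι → ℝ} (hu : u = -(((1 + Bᵀ * X * B)⁻¹ * Bᵀ * X) *ᵥ y)) :
    u ⬝ᵥ u + (y + B *ᵥ u) ⬝ᵥ (X *ᵥ (y + B *ᵥ u)) = y ⬝ᵥ (riccatiReduction B X *ᵥ y) := by
  rw [riccati_complete_square hX]
  simp [hu]

theorem riccatiReduction_posSemidef {X : Matrix ι ι ℝ} (hX : X.PosSemidef) (B : Matrix ι ι ℝ) :
    (riccatiReduction B X).PosSemidef := by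
  have hXt := posSemidef_transpose_eq hX
  have hSsymm : ((1 + Bᵀ * X * B)⁻¹)ᵀ = (1 + Bᵀ * X * B)⁻¹ :=
    posSemidef_transpose_eq (posDef_one_add_conj hX B).inv.posSemidef
  refine Matrix.PosSemidef.of_dotProduct_mulVec_nonneg ?_ fun y => ?_
  · rw [Matrix.IsHermitian, Matrix.conjTranspose_eq_transpose_of_trivial, riccatiReduction,
      Matrix.transpose_sub]
    generalize (1 + Bᵀ * X * B)⁻¹ = T at hSsymm ⊢
    simp only [Matrix.transpose_mul, hSsymm, hXt, Matrix.transpose_transpose, Matrix.mul_assoc]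
  · rw [star_trivial, ← riccatiReduction_eq hX B rfl]
    exact add_nonneg (dotProduct_self_nonneg' _) (posSemidef_dotProduct_nonneg hX _)

/-- The input `-B⁻¹ y` sends the next state to zero, so `X` drops out. The bound is uniform in `X`.
-/
theorem riccatiReduction_le_of_isUnit {X : Matrix ι ι ℝ} (hX : X.PosSemidef) {B : Matrix ι ι ℝ}
    (hB : IsUnit B) (y : ι → ℝ) :
    y ⬝ᵥ (riccatiReduction B X *ᵥ y) ≤ (B⁻¹ *ᵥ y) ⬝ᵥ (B⁻¹ *ᵥ y) := by
  have hBu := (Matrix.isUnit_iff_isUnit_det _).1 hB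
  have h := riccatiReduction_le hX B (-(B⁻¹ *ᵥ y)) y
  simpa [Matrix.mulVec_neg, Matrix.mulVec_mulVec, Matrix.mul_nonsing_inv _ hBu] using h

/-- A minimum is monotone in the objective: use the minimiser for `Y` as a trial input for `X`. -/
theorem riccatiReduction_mono {X Y : Matrix ι ι ℝ} (hX : X.PosSemidef) (hY : Y.PosSemidef)
    (hXY : ∀ x, x ⬝ᵥ (X *ᵥ x) ≤ x ⬝ᵥ (Y *ᵥ x)) (B : Matrix ι ι ℝ) (y : ι → ℝ) :
    y ⬝ᵥ (riccatiReduction B X *ᵥ y) ≤ y ⬝ᵥ (riccatiReduction B Y *ᵥ y) := by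
  rw [← riccatiReduction_eq hY B rfl]
  exact (riccatiReduction_le hX B _ y).trans (by gcongr; exact hXY _)

/-- One step of the value iteration for the Riccati equation. -/
def riccatiStep (A B X : Matrix ι ι ℝ) : Matrix ι ι ℝ :=
  1 + Aᵀ * riccatiReduction B X * A

theorem riccatiStep_posDef {X : Matrix ι ι ℝ} (hX : X.PosSemidef) (A B : Matrix ι ι ℝ) :
    (riccatiStep A B X).PosDef :=
  posDef_one_add_conj (riccatiReduction_posSemidef hX B) A

theorem riccatiStep_form (A B X : Matrix ι ι ℝ) (x : ι → ℝ) :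
    x ⬝ᵥ (riccatiStep A B X *ᵥ x) =
      x ⬝ᵥ x + (A *ᵥ x) ⬝ᵥ (riccatiReduction B X *ᵥ (A *ᵥ x)) := by
  rw [riccatiStep, Matrix.add_mulVec, Matrix.one_mulVec, dotProduct_add, ← Matrix.mulVec_mulVec,
    ← Matrix.mulVec_mulVec, dotProduct_transpose_mulVec']

/-- Value iteration from `0` has increasing quadratic forms, bounded by the deadbeat cost, so it
converges; continuity of the step makes the limit a fixed point. -/
theorem exists_riccatiStep_fixed (A : Matrix ι ι ℝ) {B : Matrix ι ι ℝ} (hB : IsUnit B) :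
    ∃ X : Matrix ι ι ℝ, X.PosDef ∧ riccatiStep A B X = X := by
  let Z : ℕ → Matrix ι ι ℝ := fun k => (riccatiStep A B)^[k] 0
  have hZs : ∀ k, Z (k + 1) = riccatiStep A B (Z k) := fun k =>
    Function.iterate_succ_apply' _ _ _
  have hZp : ∀ k, (Z k).PosSemidef := fun k => by
    induction k with
    | zero => exact Matrix.PosSemidef.zero
    | succ k ih => rw [hZs]; exact (riccatiStep_posDef ih A B).posSemidef
  have hmono : ∀ x, Monotone fun k => x ⬝ᵥ (Z k *ᵥ x) := fun x => by
    refine monotone_nat_of_le_succ fun k => ?_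
    induction k generalizing x with
    | zero => simpa [Z] using posSemidef_dotProduct_nonneg (hZp 1) x
    | succ k ih =>
      rw [hZs (k + 1), hZs k, riccatiStep_form, riccatiStep_form, ← hZs k]
      exact add_le_add le_rfl (riccatiReduction_mono (hZp k) (hZp (k + 1)) (fun x => ih x) B _)
  have hbdd : ∀ x, BddAbove (Set.range fun k => x ⬝ᵥ (Z k *ᵥ x)) := fun x => by
    refine ⟨x ⬝ᵥ x + (B⁻¹ *ᵥ (A *ᵥ x)) ⬝ᵥ (B⁻¹ *ᵥ (A *ᵥ x)), ?_⟩
    rintro _ ⟨k, rfl⟩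
    refine (hmono x (Nat.le_succ k)).trans ?_
    simp only [Nat.succ_eq_add_one]
    rw [hZs, riccatiStep_form]
    exact add_le_add le_rfl (riccatiReduction_le_of_isUnit (hZp k) hB _)
  have hlim : ∀ x, Tendsto (fun k => x ⬝ᵥ (Z k *ᵥ x)) atTop (𝓝 (⨆ k, x ⬝ᵥ (Z k *ᵥ x))) :=
    fun x => tendsto_atTop_ciSup (hmono x) (hbdd x)
  obtain ⟨X, hX⟩ : ∃ X, Tendsto Z atTop (𝓝 X) := by
    have hentry : ∀ i j, ∃ c, Tendsto (fun k => Z k i j) atTop (𝓝 c) := fun i j => by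
      simp_rw [fun k => dotProduct_mulVec_polarization (posSemidef_transpose_eq (hZp k)) i j]
      exact ⟨_, (((hlim _).sub (hlim _)).sub (hlim _)).div_const 2⟩
    choose c hc using hentry
    exact ⟨Matrix.of c, tendsto_pi_nhds.2 fun i => tendsto_pi_nhds.2 fun j => hc i j⟩
  have hform : ∀ x, Tendsto (fun k => x ⬝ᵥ (Z k *ᵥ x)) atTop (𝓝 (x ⬝ᵥ (X *ᵥ x))) := fun x =>
    ((by fun_prop : Continuous fun Y : Matrix ι ι ℝ => x ⬝ᵥ (Y *ᵥ x)).tendsto X).comp hX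
  have hXp : X.PosSemidef := by
    refine Matrix.PosSemidef.of_dotProduct_mulVec_nonneg ?_ fun x => ?_
    · rw [Matrix.IsHermitian, Matrix.conjTranspose_eq_transpose_of_trivial]
      refine tendsto_nhds_unique
        (((by fun_prop : Continuous fun Y : Matrix ι ι ℝ => Yᵀ).tendsto X).comp hX) ?_
      exact hX.congr fun k => (posSemidef_transpose_eq (hZp k)).symm
    · rw [star_trivial]
      exact ge_of_tendsto' (hform x) fun k => posSemidef_dotProduct_nonneg (hZp k) x
  have hfix : riccatiStep A B X = X := by
    refine tendsto_nhds_unique ?_ ((tendsto_add_atTop_iff_nat 1).2 hX)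
    simp_rw [hZs]
    have hdet : (1 + Bᵀ * X * B).det ≠ 0 := (posDef_one_add_conj hXp B).det_pos.ne'
    have hcont : ContinuousAt (fun Y : Matrix ι ι ℝ => riccatiStep A B Y) X := by
      have hinv : ContinuousAt (fun Y : Matrix ι ι ℝ => (1 + Bᵀ * Y * B)⁻¹) X := by
        have hc : Continuous fun Y : Matrix ι ι ℝ => 1 + Bᵀ * Y * B := by fun_prop
        simp_rw [Matrix.inv_def, Ring.inverse_eq_inv']
        exact (hc.matrix_det.continuousAt.inv₀ hdet).smul hc.matrix_adjugate.continuousAt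
      unfold riccatiStep riccatiReduction
      fun_prop
    exact hcont.tendsto.comp hX
  -- The fixed point equation exhibits `X` as `1` plus a positive semidefinite matrix.
  exact ⟨X, hfix ▸ riccatiStep_posDef hXp A B, hfix⟩

theorem isRiccatiSolution_iff {m : ℕ} (A B X : Matrix (Fin m) (Fin m) ℝ) :
    IsRiccatiSolution A B X ↔ X.PosDef ∧ riccatiStep A B X = X := by
  refine and_congr_right fun _ => ?_
  rw [eq_comm (a := riccatiStep A B X), ← sub_eq_zero (a := X), riccatiStep, riccatiReduction]
  refine Eq.congr_left ?_
  simp only [Matrix.mul_sub, Matrix.sub_mul, Matrix.mul_assoc]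
  abel

theorem riccati_form_eq {A B X : Matrix ι ι ℝ} (hX : riccatiStep A B X = X) (x : ι → ℝ) :
    x ⬝ᵥ (X *ᵥ x) = x ⬝ᵥ x + (A *ᵥ x) ⬝ᵥ (riccatiReduction B X *ᵥ (A *ᵥ x)) := by
  rw [← riccatiStep_form, hX]

/-- Telescoping of the one-step inequality. The first drift `y 0` is left free, since for a sink it
also contains contributions of nonsink initial states. -/
theorem riccati_value_le_sum {A B X : Matrix ι ι ℝ} (hXp : X.PosSemidef)
    (hX : riccatiStep A B X = X) {x u y : ℕ → ι → ℝ}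
    (hx : ∀ k, x (k + 1) = y k + B *ᵥ u k) (hy : ∀ k, y (k + 1) = A *ᵥ x (k + 1)) (N : ℕ) :
    y 0 ⬝ᵥ (riccatiReduction B X *ᵥ y 0) ≤
      ∑ k ∈ Finset.range N, (x (k + 1) ⬝ᵥ x (k + 1) + u k ⬝ᵥ u k) +
        y N ⬝ᵥ (riccatiReduction B X *ᵥ y N) := by
  induction N with
  | zero => simp
  | succ N ih =>
    have h := riccatiReduction_le hXp B (u N) (y N)
    rw [← hx, riccati_form_eq hX, ← hy] at h
    rw [Finset.sum_range_succ]
    linarith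

theorem riccati_value_eq_sum {A B X : Matrix ι ι ℝ} (hXp : X.PosSemidef)
    (hX : riccatiStep A B X = X) {x u y : ℕ → ι → ℝ}
    (hx : ∀ k, x (k + 1) = y k + B *ᵥ u k) (hy : ∀ k, y (k + 1) = A *ᵥ x (k + 1))
    (hu : ∀ k, u k = -(((1 + Bᵀ * X * B)⁻¹ * Bᵀ * X) *ᵥ y k)) (N : ℕ) :
    y 0 ⬝ᵥ (riccatiReduction B X *ᵥ y 0) =
      ∑ k ∈ Finset.range N, (x (k + 1) ⬝ᵥ x (k + 1) + u k ⬝ᵥ u k) +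
        y N ⬝ᵥ (riccatiReduction B X *ᵥ y N) := by
  induction N with
  | zero => simp
  | succ N ih =>
    have h := riccatiReduction_eq hXp B (hu N)
    rw [← hx, riccati_form_eq hX, ← hy] at h
    rw [Finset.sum_range_succ]
    linarith

/-- Every input sequence costs at least the Riccati value of the first drift. -/
theorem riccati_value_le_tsum {A B X : Matrix ι ι ℝ} (hXp : X.PosSemidef)
    (hX : riccatiStep A B X = X) {x u y : ℕ → ι → ℝ}
    (hx : ∀ k, x (k + 1) = y k + B *ᵥ u k) (hy : ∀ k, y (k + 1) = A *ᵥ x (k + 1)) :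
    ENNReal.ofReal (y 0 ⬝ᵥ (riccatiReduction B X *ᵥ y 0)) ≤
      ∑' k, ENNReal.ofReal (x (k + 1) ⬝ᵥ x (k + 1) + u k ⬝ᵥ u k) := by
  have hnn : ∀ k, 0 ≤ x (k + 1) ⬝ᵥ x (k + 1) + u k ⬝ᵥ u k := fun k =>
    add_nonneg (dotProduct_self_nonneg' _) (dotProduct_self_nonneg' _)
  by_cases htop : ∑' k, ENNReal.ofReal (x (k + 1) ⬝ᵥ x (k + 1) + u k ⬝ᵥ u k) = ⊤
  · rw [htop]; exact le_top
  have hsum : Summable fun k => x (k + 1) ⬝ᵥ x (k + 1) + u k ⬝ᵥ u k := by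
    have := ENNReal.summable_toReal htop
    simpa only [ENNReal.toReal_ofReal (hnn _)] using this
  rw [← ENNReal.ofReal_tsum_of_nonneg hnn hsum]
  refine ENNReal.ofReal_le_ofReal ?_
  -- Finite cost forces the state to zero, which kills the terminal term.
  have hx0 : Tendsto (fun k => x (k + 1)) atTop (𝓝 0) := by
    refine tendsto_pi_nhds.2 fun i => ?_
    rw [Pi.zero_apply]
    refine squeeze_zero_norm (a := fun k => √(x (k + 1) ⬝ᵥ x (k + 1) + u k ⬝ᵥ u k))
      (fun k => Real.abs_le_sqrt ?_) ?_
    · have h1 : x (k + 1) i ^ 2 ≤ x (k + 1) ⬝ᵥ x (k + 1) := by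
        rw [sq]
        exact Finset.single_le_sum (f := fun j => x (k + 1) j * x (k + 1) j)
          (fun j _ => mul_self_nonneg _) (Finset.mem_univ i)
      linarith [dotProduct_self_nonneg' (u k)]
    · simpa using hsum.tendsto_atTop_zero.sqrt
  -- Shifted by one because `y 0` need not be `A` applied to a state.
  have hlast : Tendsto (fun N => y (N + 1) ⬝ᵥ (riccatiReduction B X *ᵥ y (N + 1))) atTop
      (𝓝 0) := by
    have hc : Continuous fun z : ι → ℝ =>
        (A *ᵥ z) ⬝ᵥ (riccatiReduction B X *ᵥ (A *ᵥ z)) := by fun_prop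
    have := (hc.tendsto 0).comp hx0
    simp only [Matrix.mulVec_zero, dotProduct_zero] at this
    exact this.congr fun k => by simp [hy]
  have hpart := (tendsto_add_atTop_iff_nat 1).2 hsum.hasSum.tendsto_sum_nat
  have := hpart.add hlast
  rw [add_zero] at this
  exact ge_of_tendsto' this fun N => riccati_value_le_sum hXp hX hx hy (N + 1)

/-- The Riccati feedback attains the Riccati value of the first drift. -/
theorem riccati_tsum_le_value {A B X : Matrix ι ι ℝ} (hXp : X.PosSemidef)
    (hX : riccatiStep A B X = X) {x u y : ℕ → ι → ℝ}
    (hx : ∀ k, x (k + 1) = y k + B *ᵥ u k) (hy : ∀ k, y (k + 1) = A *ᵥ x (k + 1))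
    (hu : ∀ k, u k = -(((1 + Bᵀ * X * B)⁻¹ * Bᵀ * X) *ᵥ y k)) :
    ∑' k, ENNReal.ofReal (x (k + 1) ⬝ᵥ x (k + 1) + u k ⬝ᵥ u k) ≤
      ENNReal.ofReal (y 0 ⬝ᵥ (riccatiReduction B X *ᵥ y 0)) := by
  have hnn : ∀ k, 0 ≤ x (k + 1) ⬝ᵥ x (k + 1) + u k ⬝ᵥ u k := fun k =>
    add_nonneg (dotProduct_self_nonneg' _) (dotProduct_self_nonneg' _)
  rw [ENNReal.tsum_eq_iSup_nat]
  refine iSup_le fun N => ?_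
  rw [← ENNReal.ofReal_sum_of_nonneg fun k _ => hnn k]
  refine ENNReal.ofReal_le_ofReal ?_
  rw [riccati_value_eq_sum hXp hX hx hy hu N]
  linarith [posSemidef_dotProduct_nonneg (riccatiReduction_posSemidef hXp B) (y N)]

/-- The trajectory from `x₀` under the Riccati feedback of `X`. -/
def riccatiTrajectory (A B X : Matrix ι ι ℝ) (x₀ : ι → ℝ) : ℕ → ι → ℝ :=
  fun k => (fun z => A *ᵥ z + B *ᵥ (-(((1 + Bᵀ * X * B)⁻¹ * Bᵀ * X) *ᵥ (A *ᵥ z))))^[k] x₀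

/-- The feedback of `Y` attains the value of `Y`, while the value of `X` bounds the cost of any
input sequence from below. -/
theorem riccati_form_le {A B X Y : Matrix ι ι ℝ} (hXp : X.PosSemidef) (hYp : Y.PosSemidef)
    (hX : riccatiStep A B X = X) (hY : riccatiStep A B Y = Y) (x₀ : ι → ℝ) :
    x₀ ⬝ᵥ (X *ᵥ x₀) ≤ x₀ ⬝ᵥ (Y *ᵥ x₀) := by
  rw [riccati_form_eq hX, riccati_form_eq hY]
  refine add_le_add le_rfl ?_
  have hx : ∀ k, riccatiTrajectory A B Y x₀ (k + 1) = A *ᵥ riccatiTrajectory A B Y x₀ k +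
      B *ᵥ (-(((1 + Bᵀ * Y * B)⁻¹ * Bᵀ * Y) *ᵥ (A *ᵥ riccatiTrajectory A B Y x₀ k))) :=
    fun k => Function.iterate_succ_apply' _ _ _
  have h1 := riccati_value_le_tsum hXp hX hx fun _ => rfl
  have h2 := riccati_tsum_le_value hYp hY hx (fun _ => rfl) fun _ => rfl
  exact (ENNReal.ofReal_le_ofReal_iff (posSemidef_dotProduct_nonneg
    (riccatiReduction_posSemidef hYp B) _)).1 (h1.trans h2)

end Riccati

theorem existsUnique_isRiccatiSolution {m : ℕ} (A : Matrix (Fin m) (Fin m) ℝ)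
    {B : Matrix (Fin m) (Fin m) ℝ} (hB : IsUnit B) : ∃! X, IsRiccatiSolution A B X := by
  obtain ⟨X, hXp, hX⟩ := exists_riccatiStep_fixed A hB
  refine ⟨X, (isRiccatiSolution_iff A B X).2 ⟨hXp, hX⟩, fun Y hY => ?_⟩
  obtain ⟨hYp, hY⟩ := (isRiccatiSolution_iff A B Y).1 hY
  have hXs := hXp.posSemidef
  have hYs := hYp.posSemidef
  exact eq_of_dotProduct_mulVec_eq (posSemidef_transpose_eq hYs) (posSemidef_transpose_eq hXs)
    fun x => le_antisymm (riccati_form_le hYs hXs hY hX x) (riccati_form_le hXs hYs hX hY x)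

theorem isRiccatiSolution_riccatiSolution {m : ℕ} (A : Matrix (Fin m) (Fin m) ℝ)
    {B : Matrix (Fin m) (Fin m) ℝ} (hB : IsUnit B) :
    IsRiccatiSolution A B (riccatiSolution A B) := by
  have h := (existsUnique_isRiccatiSolution A hB).exists
  rw [riccatiSolution, dif_pos h]
  exact h.choose_spec


/-! ### The smallest singular value as a lower bound for stretching -/

section SingularValues

open Module

/-- The smallest singular value is the largest lower bound for the stretching factor. -/
theorem le_singularValues_finrank_sub_one_iff {E F : Type*} [NormedAddCommGroup E]
    [InnerProductSpace ℝ E] [FiniteDimensional ℝ E] [NormedAddCommGroup F] [InnerProductSpace ℝ F]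
    [FiniteDimensional ℝ F] [Nontrivial E] (T : E →ₗ[ℝ] F) {ε : ℝ} (hε : 0 ≤ ε) :
    ε ≤ T.singularValues (finrank ℝ E - 1) ↔ ∀ x, ε ^ 2 * ‖x‖ ^ 2 ≤ ‖T x‖ ^ 2 := by
  have hpos : 0 < finrank ℝ E := finrank_pos
  have hlt : finrank ℝ E - 1 < finrank ℝ E := Nat.sub_lt hpos one_pos
  have hsymm := T.isSymmetric_adjoint_comp_self
  have hnorm : ∀ x, ‖T x‖ ^ 2 = inner ℝ x ((LinearMap.adjoint T ∘ₗ T) x) := fun x => by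
    rw [LinearMap.comp_apply, LinearMap.adjoint_inner_right, real_inner_self_eq_norm_sq]
  constructor
  · intro h x
    set b := hsymm.eigenvectorBasis rfl
    have hx : ‖T x‖ ^ 2 = ∑ i, hsymm.eigenvalues rfl i * b.repr x i ^ 2 := by
      rw [hnorm, ← b.repr.inner_map_map, PiLp.inner_apply]
      refine Finset.sum_congr rfl fun i _ => ?_
      rw [hsymm.eigenvectorBasis_apply_self_apply]
      simp only [RCLike.inner_apply, conj_trivial, RCLike.ofReal_real_eq_id, id_eq]
      ring
    have hx' : ‖x‖ ^ 2 = ∑ i, b.repr x i ^ 2 := by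
      rw [← b.repr.norm_map, EuclideanSpace.real_norm_sq_eq]
    rw [hx, hx', Finset.mul_sum]
    refine Finset.sum_le_sum fun i _ => mul_le_mul_of_nonneg_right ?_ (sq_nonneg _)
    have hi : T.singularValues (finrank ℝ E - 1) ≤ T.singularValues i :=
      T.singularValues_antitone (Nat.le_sub_one_of_lt i.2)
    rw [← T.sq_singularValues_fin rfl i]
    exact pow_le_pow_left₀ hε (h.trans hi) 2
  · intro h
    -- An eigenvector for the last singular value attains the bound.
    obtain ⟨v, hv⟩ := (T.hasEigenvalue_adjoint_comp_self_sq_singularValues hlt).exists_hasEigenvector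
    have h1 := h v
    rw [hnorm, hv.apply_eq_smul, inner_smul_right, real_inner_self_eq_norm_sq] at h1
    have hv0 : 0 < ‖v‖ ^ 2 := pow_pos (norm_pos_iff.2 hv.2) 2
    exact le_of_sq_le_sq (le_of_mul_le_mul_right h1 hv0) (T.singularValues_nonneg _)

end SingularValues

/-! ### Splitting vectors and cost by subsystem -/

variable {q : ℕ} {n : Fin q → ℕ}

/-- The part of a state or input vector belonging to subsystem `i`. -/
def segment (x : StateIdx n → ℝ) (i : Fin q) : Fin (n i) → ℝ := fun a => x ⟨i, a⟩

theorem dotProduct_eq_sum_segment (x y : StateIdx n → ℝ) :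
    x ⬝ᵥ y = ∑ i, segment x i ⬝ᵥ segment y i :=
  Fintype.sum_sigma _

theorem segment_add (x y : StateIdx n → ℝ) (i : Fin q) :
    segment (x + y) i = segment x i + segment y i := rfl

theorem segment_neg (x : StateIdx n → ℝ) (i : Fin q) : segment (-x) i = -segment x i := rfl

theorem segment_mulVec (M : SysMatrix n) (x : StateIdx n → ℝ) (i : Fin q) :
    segment (M *ᵥ x) i = blockRow M i *ᵥ x := rfl

theorem segment_mulVec_eq_sum (M : SysMatrix n) (x : StateIdx n → ℝ) (i : Fin q) :
    segment (M *ᵥ x) i = ∑ j, block M i j *ᵥ segment x j := by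
  ext a
  rw [Finset.sum_apply]
  exact Fintype.sum_sigma _

theorem segment_mulVec_of_forall_ne (M : SysMatrix n) (x : StateIdx n → ℝ) (i : Fin q)
    (h : ∀ j, j ≠ i → block M i j *ᵥ segment x j = 0) :
    segment (M *ᵥ x) i = block M i i *ᵥ segment x i := by
  rw [segment_mulVec_eq_sum]
  exact Finset.sum_eq_single i (fun j _ hj => h j hj) (by simp)

theorem segment_mulVec_of_blockDiag {M : SysMatrix n} (hM : ∀ i j, i ≠ j → block M i j = 0)
    (x : StateIdx n → ℝ) (i : Fin q) : segment (M *ᵥ x) i = block M i i *ᵥ segment x i :=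
  segment_mulVec_of_forall_ne M x i fun j hj => by rw [hM i j hj.symm, Matrix.zero_mulVec]

/-- The part of the closed-loop cost belonging to subsystem `i`. -/
def segmentCost (A B : SysMatrix n) (x₀ : StateIdx n → ℝ) (K : SysMatrix n) (i : Fin q) : ENNReal :=
  ∑' k : ℕ, ENNReal.ofReal
    (segment (trajectory A B K x₀ (k + 1)) i ⬝ᵥ segment (trajectory A B K x₀ (k + 1)) i +
      segment (K *ᵥ trajectory A B K x₀ k) i ⬝ᵥ segment (K *ᵥ trajectory A B K x₀ k) i)

theorem cost_eq_sum_segmentCost (A B : SysMatrix n) (x₀ : StateIdx n → ℝ) (K : SysMatrix n) :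
    cost A B x₀ K = ∑ i, segmentCost A B x₀ K i := by
  simp only [cost, segmentCost]
  rw [← ENNReal.tsum_add, ← tsum_fintype (L := .unconditional _), ENNReal.tsum_comm]
  refine tsum_congr fun k => ?_
  rw [tsum_fintype, dotProduct_eq_sum_segment,
    dotProduct_eq_sum_segment (K *ᵥ trajectory A B K x₀ k),
    ← ENNReal.ofReal_add (Finset.sum_nonneg fun i _ => dotProduct_self_nonneg' _)
      (Finset.sum_nonneg fun i _ => dotProduct_self_nonneg' _), ← Finset.sum_add_distrib,
    ENNReal.ofReal_sum_of_nonneg fun i _ =>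
      add_nonneg (dotProduct_self_nonneg' _) (dotProduct_self_nonneg' _)]

/-! ### The two classes of input matrices -/

theorem sq_norm_toLp (x : StateIdx n → ℝ) : ‖WithLp.toLp 2 x‖ ^ 2 = x ⬝ᵥ x := by
  rw [EuclideanSpace.real_norm_sq_eq]
  exact Finset.sum_congr rfl fun i _ => sq _

theorem le_minSingularValue_iff [Nonempty (StateIdx n)] (M : SysMatrix n) {ε : ℝ} (hε : 0 ≤ ε) :
    ε ≤ minSingularValue M ↔ ∀ x, ε ^ 2 * (x ⬝ᵥ x) ≤ (M *ᵥ x) ⬝ᵥ (M *ᵥ x) := by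
  have h := le_singularValues_finrank_sub_one_iff (Matrix.toEuclideanLin M) hε
  rw [finrank_euclideanSpace] at h
  rw [minSingularValue, h, (WithLp.equiv 2 (StateIdx n → ℝ)).symm.surjective.forall]
  refine forall_congr' fun x => ?_
  rw [WithLp.equiv_symm_apply, Matrix.toLpLin_toLp, sq_norm_toLp, sq_norm_toLp]
  rfl

/-- Membership in `inputMatrices` is a condition on each diagonal block. -/
theorem mem_inputMatrices_iff [Nonempty (StateIdx n)] (B : SysMatrix n) {ε : ℝ} (hε : 0 ≤ ε) :
    B ∈ inputMatrices n ε ↔ (∀ i (v : Fin (n i) → ℝ),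
      ε ^ 2 * (v ⬝ᵥ v) ≤ (block B i i *ᵥ v) ⬝ᵥ (block B i i *ᵥ v)) ∧
        ∀ i j, i ≠ j → block B i j = 0 := by
  refine and_congr_left fun hB => ?_
  rw [le_minSingularValue_iff B hε]
  constructor
  · intro h i v
    -- Test the global bound on the vector equal to `v` on block `i` and zero elsewhere.
    let x : StateIdx n → ℝ := fun p => (Pi.single i v : ∀ j, Fin (n j) → ℝ) p.1 p.2
    have hx : ∀ j, segment x j = (Pi.single i v : ∀ j, Fin (n j) → ℝ) j := fun j => rfl
    have h1 := h x
    rw [dotProduct_eq_sum_segment, dotProduct_eq_sum_segment, Finset.sum_eq_single i,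
      Finset.sum_eq_single i, segment_mulVec_of_blockDiag hB, hx, Pi.single_eq_same] at h1
    · exact h1
    · intro j _ hj
      rw [segment_mulVec_of_blockDiag hB, hx, Pi.single_eq_of_ne hj]
      simp
    · simp
    · intro j _ hj
      rw [hx, Pi.single_eq_of_ne hj]
      simp
    · simp
  · intro h x
    rw [dotProduct_eq_sum_segment, dotProduct_eq_sum_segment, Finset.mul_sum]
    refine Finset.sum_le_sum fun i _ => ?_
    rw [segment_mulVec_of_blockDiag hB]
    exact h i _

/-- The input matrix obtained from `B` by replacing the diagonal block `l` by `b • 1`. -/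
def replaceInputBlock (B : SysMatrix n) (l : Fin q) (b : ℝ) : SysMatrix n :=
  Matrix.blockDiagonal' (Function.update (fun i => block B i i) l (b • 1))

theorem block_blockDiagonal' (D : ∀ i, Matrix (Fin (n i)) (Fin (n i)) ℝ) (i : Fin q) :
    block (Matrix.blockDiagonal' D) i i = D i := by
  ext a c
  exact Matrix.blockDiagonal'_apply_eq D i a c

theorem block_blockDiagonal'_of_ne (D : ∀ i, Matrix (Fin (n i)) (Fin (n i)) ℝ) (i j : Fin q)
    (h : i ≠ j) : block (Matrix.blockDiagonal' D) i j = 0 := by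
  ext a c
  exact Matrix.blockDiagonal'_apply_ne D a c h

theorem block_replaceInputBlock_same (B : SysMatrix n) (l : Fin q) (b : ℝ) :
    block (replaceInputBlock B l b) l l = b • 1 := by
  rw [replaceInputBlock, block_blockDiagonal', Function.update_self]

theorem block_replaceInputBlock_of_ne (B : SysMatrix n) {i l : Fin q} (h : i ≠ l) (b : ℝ) :
    block (replaceInputBlock B l b) i i = block B i i := by
  rw [replaceInputBlock, block_blockDiagonal', Function.update_of_ne h]

theorem replaceInputBlock_mem_inputMatrices [Nonempty (StateIdx n)] {B : SysMatrix n} {ε b : ℝ}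
    (hε : 0 ≤ ε) (hb : ε ≤ b) (hB : B ∈ inputMatrices n ε) (l : Fin q) :
    replaceInputBlock B l b ∈ inputMatrices n ε := by
  rw [mem_inputMatrices_iff _ hε] at hB ⊢
  refine ⟨fun i v => ?_, fun i j h => block_blockDiagonal'_of_ne _ _ _ h⟩
  rcases eq_or_ne i l with rfl | hi
  · rw [block_replaceInputBlock_same, Matrix.smul_mulVec, Matrix.one_mulVec, smul_dotProduct,
      dotProduct_smul, smul_eq_mul, smul_eq_mul, ← mul_assoc, ← sq]
    exact mul_le_mul_of_nonneg_right (pow_le_pow_left₀ hε hb 2) (dotProduct_self_nonneg' v)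
  · rw [block_replaceInputBlock_of_ne B hi]
    exact hB.1 i v

theorem replaceInputBlock_mem_diagInputMatrices {B : SysMatrix n} {ε b : ℝ} (hb : ε ≤ b)
    (hB : B ∈ diagInputMatrices n ε) (l : Fin q) :
    replaceInputBlock B l b ∈ diagInputMatrices n ε := by
  refine ⟨?_, ?_⟩
  · rintro ⟨i, a⟩ ⟨j, c⟩ h
    rcases eq_or_ne i j with rfl | hij
    · have hac : a ≠ c := fun hac => h (by rw [hac])
      change block (replaceInputBlock B l b) i i a c = 0
      rcases eq_or_ne i l with rfl | hi
      · simp [block_replaceInputBlock_same, hac]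
      · rw [block_replaceInputBlock_of_ne B hi]
        exact hB.1 h
    · exact congrFun₂ (block_blockDiagonal'_of_ne _ i j hij) a c
  · rintro ⟨i, a⟩
    change ε ≤ block (replaceInputBlock B l b) i i a a
    rcases eq_or_ne i l with rfl | hi
    · simpa [block_replaceInputBlock_same] using hb
    · rw [block_replaceInputBlock_of_ne B hi]
      exact hB.2 _

theorem isUnit_block_of_mem_inputMatrices [Nonempty (StateIdx n)] {B : SysMatrix n} {ε : ℝ}
    (hε : 0 < ε) (hB : B ∈ inputMatrices n ε) (i : Fin q) : IsUnit (block B i i) := by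
  rw [← Matrix.mulVec_injective_iff_isUnit]
  refine (injective_iff_map_eq_zero (Matrix.mulVecLin (block B i i))).2 fun v hv => ?_
  have h := ((mem_inputMatrices_iff B hε.le).1 hB).1 i v
  rw [Matrix.mulVecLin_apply] at hv
  rw [hv, zero_dotProduct] at h
  exact dotProduct_self_eq_zero.1 (le_antisymm (nonpos_of_mul_nonpos_right h (by positivity))
    (dotProduct_self_nonneg' v))

theorem isUnit_block_of_mem_diagInputMatrices {B : SysMatrix n} {ε : ℝ} (hε : 0 < ε)
    (hB : B ∈ diagInputMatrices n ε) (i : Fin q) : IsUnit (block B i i) := by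
  have h : block B i i = Matrix.diagonal fun a => B ⟨i, a⟩ ⟨i, a⟩ := by
    ext a c
    rcases eq_or_ne a c with rfl | hac
    · simp [block]
    · rw [Matrix.diagonal_apply_ne _ hac]
      exact hB.1 (by simpa using hac)
  rw [h, Matrix.isUnit_diagonal, Pi.isUnit_iff]
  exact fun a => (hε.trans_le (hB.2 _)).ne'.isUnit

/-- The properties of the admissible input matrices on which the optimality argument rests. -/
structure IsInputClass (𝓑 : Set (SysMatrix n)) : Prop where
  blockDiag : ∀ B ∈ 𝓑, ∀ i j, i ≠ j → block B i j = 0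
  isUnit : ∀ B ∈ 𝓑, ∀ i, IsUnit (block B i i)
  replace : ∃ ε : ℝ, 0 < ε ∧ ∀ B ∈ 𝓑, ∀ l, ∀ b, ε ≤ b → replaceInputBlock B l b ∈ 𝓑

theorem isInputClass_of_eq [Nonempty (StateIdx n)] {ε : ℝ} (hε : 0 < ε) {𝓑 : Set (SysMatrix n)}
    (h𝓑 : 𝓑 = inputMatrices n ε ∨ 𝓑 = diagInputMatrices n ε) : IsInputClass 𝓑 := by
  rcases h𝓑 with rfl | rfl
  · exact ⟨fun B hB => hB.2, fun B hB => isUnit_block_of_mem_inputMatrices hε hB,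
      ε, hε, fun B hB l b hb => replaceInputBlock_mem_inputMatrices hε.le hb hB l⟩
  · refine ⟨fun B hB i j hij => ?_, fun B hB => isUnit_block_of_mem_diagInputMatrices hε hB,
      ε, hε, fun B hB l b hb => replaceInputBlock_mem_diagInputMatrices hb hB l⟩
    ext a c
    exact hB.1 (by simp [hij])


/-! ### Optimality among controllers that are deadbeat on nonsinks -/

variable {GP GK : Digraph (Fin q)} {A B K : SysMatrix n}

theorem segment_trajectory_succ (hB : ∀ i j, i ≠ j → block B i j = 0) (x₀ : StateIdx n → ℝ)
    (k : ℕ) (i : Fin q) :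
    segment (trajectory A B K x₀ (k + 1)) i = segment (A *ᵥ trajectory A B K x₀ k) i +
      block B i i *ᵥ segment (K *ᵥ trajectory A B K x₀ k) i := by
  rw [trajectory, segment_add, segment_mulVec_of_blockDiag hB]

/-- When the nonsink states vanish, the sinks evolve independently of each other. -/
theorem segment_mulVec_of_nonsink_eq_zero (hA : A ∈ structuredMatrices n GP) {x : StateIdx n → ℝ}
    (hx : ∀ j, ¬ IsSink GP j → segment x j = 0) (i : Fin q) :
    segment (A *ᵥ x) i = block A i i *ᵥ segment x i := by
  refine segment_mulVec_of_forall_ne A x i fun j hj => ?_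
  by_cases hs : IsSink GP j
  · rw [hA i j (hs i hj.symm), Matrix.zero_mulVec]
  · rw [hx j hs, Matrix.mulVec_zero]

/-- The controller cancels the drift of every nonsink subsystem. -/
def IsDeadbeatOnNonsinks (GP : Digraph (Fin q)) (A B K : SysMatrix n) : Prop :=
  ∀ i, ¬ IsSink GP i → ∀ x, segment (K *ᵥ x) i = -((block B i i)⁻¹ *ᵥ segment (A *ᵥ x) i)

theorem IsDeadbeatOnNonsinks.segment_trajectory (hK : IsDeadbeatOnNonsinks GP A B K)
    (hB : ∀ i j, i ≠ j → block B i j = 0) (x₀ : StateIdx n → ℝ) (k : ℕ) {i : Fin q}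
    (hBi : IsUnit (block B i i)) (hi : ¬ IsSink GP i) :
    segment (trajectory A B K x₀ (k + 1)) i = 0 := by
  rw [segment_trajectory_succ hB, hK i hi, Matrix.mulVec_neg, Matrix.mulVec_mulVec,
    Matrix.mul_nonsing_inv _ ((Matrix.isUnit_iff_isUnit_det _).1 hBi), Matrix.one_mulVec,
    add_neg_cancel]

open Classical in
/-- The least cost of subsystem `i` caused by its first drift, under `gammaTheta`. -/
def segmentValue (GP : Digraph (Fin q)) (A B : SysMatrix n) (x₀ : StateIdx n → ℝ) (i : Fin q) : ℝ :=
  if IsSink GP i then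
    segment (A *ᵥ x₀) i ⬝ᵥ (riccatiReduction (block B i i)
      (riccatiSolution (block A i i) (block B i i)) *ᵥ segment (A *ᵥ x₀) i)
  else ((block B i i)⁻¹ *ᵥ segment (A *ᵥ x₀) i) ⬝ᵥ ((block B i i)⁻¹ *ᵥ segment (A *ᵥ x₀) i)

theorem segmentValue_le (x₀ : StateIdx n → ℝ) {i : Fin q} (hBi : IsUnit (block B i i)) :
    segmentValue GP A B x₀ i ≤
      ((block B i i)⁻¹ *ᵥ segment (A *ᵥ x₀) i) ⬝ᵥ ((block B i i)⁻¹ *ᵥ segment (A *ᵥ x₀) i) := by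
  rw [segmentValue]
  split_ifs
  · exact riccatiReduction_le_of_isUnit
      (isRiccatiSolution_riccatiSolution (block A i i) hBi).1.posSemidef hBi _
  · exact le_rfl

open Classical in
theorem segment_gammaTheta_mulVec (x : StateIdx n → ℝ) (i : Fin q) :
    segment (gammaTheta n GP A B *ᵥ x) i =
      -((if IsSink GP i then lqrFactor (block A i i) (block B i i) else (block B i i)⁻¹) *ᵥ
        segment (A *ᵥ x) i) := by
  rw [gammaTheta, Matrix.neg_mulVec, ← Matrix.mulVec_mulVec, segment_neg,
    segment_mulVec_of_blockDiag fun i j h => block_blockDiagonal'_of_ne _ i j h,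
    block_blockDiagonal']

theorem isDeadbeatOnNonsinks_gammaTheta : IsDeadbeatOnNonsinks GP A B (gammaTheta n GP A B) :=
  fun i hi x => by rw [segment_gammaTheta_mulVec, if_neg hi]

/-- From time 1 the nonsink states are zero, so a sink is an autonomous LQR problem after its first
drift. A nonsink pays at least for its input at time 0. -/
theorem le_segmentCost_of_isDeadbeatOnNonsinks (hA : A ∈ structuredMatrices n GP)
    (hB : ∀ i j, i ≠ j → block B i j = 0) (hBu : ∀ i, IsUnit (block B i i))
    (hK : IsDeadbeatOnNonsinks GP A B K) (x₀ : StateIdx n → ℝ) (i : Fin q) :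
    ENNReal.ofReal (segmentValue GP A B x₀ i) ≤ segmentCost A B x₀ K i := by
  rw [segmentValue]
  split_ifs with hi
  · obtain ⟨hXp, hX⟩ := (isRiccatiSolution_iff _ _ _).1
      (isRiccatiSolution_riccatiSolution (block A i i) (hBu i))
    exact riccati_value_le_tsum hXp.posSemidef hX
      (y := fun k => segment (A *ᵥ trajectory A B K x₀ k) i)
      (x := fun k => segment (trajectory A B K x₀ k) i)
      (fun k => segment_trajectory_succ hB x₀ k i)
      fun k => segment_mulVec_of_nonsink_eq_zero hA
        (fun j hj => hK.segment_trajectory hB x₀ k (hBu j) hj) i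
  · refine le_trans (ENNReal.ofReal_le_ofReal ?_) (ENNReal.le_tsum 0)
    rw [trajectory, hK i hi, neg_dotProduct_neg]
    exact le_add_of_nonneg_left (dotProduct_self_nonneg' _)

theorem segmentCost_gammaTheta_le (hA : A ∈ structuredMatrices n GP)
    (hB : ∀ i j, i ≠ j → block B i j = 0) (hBu : ∀ i, IsUnit (block B i i))
    (x₀ : StateIdx n → ℝ) (i : Fin q) :
    segmentCost A B x₀ (gammaTheta n GP A B) i ≤ ENNReal.ofReal (segmentValue GP A B x₀ i) := by
  have hK := isDeadbeatOnNonsinks_gammaTheta (GP := GP) (A := A) (B := B)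
  have hz : ∀ k j, ¬ IsSink GP j →
      segment (trajectory A B (gammaTheta n GP A B) x₀ (k + 1)) j = 0 := fun k j hj =>
    hK.segment_trajectory hB x₀ k (hBu j) hj
  rw [segmentValue]
  split_ifs with hi
  · obtain ⟨hXp, hX⟩ := (isRiccatiSolution_iff _ _ _).1
      (isRiccatiSolution_riccatiSolution (block A i i) (hBu i))
    refine riccati_tsum_le_value hXp.posSemidef hX
      (y := fun k => segment (A *ᵥ trajectory A B (gammaTheta n GP A B) x₀ k) i)
      (x := fun k => segment (trajectory A B (gammaTheta n GP A B) x₀ k) i)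
      (fun k => segment_trajectory_succ hB x₀ k i)
      (fun k => segment_mulVec_of_nonsink_eq_zero hA (hz k) i) fun k => ?_
    rw [segment_gammaTheta_mulVec, if_pos hi, lqrFactor]
  · rw [segmentCost, tsum_eq_single 0]
    · rw [hz 0 i hi, trajectory, hK i hi, neg_dotProduct_neg, zero_dotProduct, zero_add]
    · intro k hk
      obtain ⟨k, rfl⟩ := Nat.exists_eq_succ_of_ne_zero hk
      rw [hz _ i hi, hK i hi, segment_mulVec_of_nonsink_eq_zero hA (hz k), hz k i hi]
      simp

/-- A bound free of Riccati solutions, so that the adversarial plant can be treated without knowing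
whether the target node is a sink. -/
theorem cost_gammaTheta_le (hA : A ∈ structuredMatrices n GP)
    (hB : ∀ i j, i ≠ j → block B i j = 0) (hBu : ∀ i, IsUnit (block B i i))
    (x₀ : StateIdx n → ℝ) :
    cost A B x₀ (gammaTheta n GP A B) ≤
      ∑ i, ENNReal.ofReal (((block B i i)⁻¹ *ᵥ segment (A *ᵥ x₀) i) ⬝ᵥ
        ((block B i i)⁻¹ *ᵥ segment (A *ᵥ x₀) i)) := by
  rw [cost_eq_sum_segmentCost]
  exact Finset.sum_le_sum fun i _ => (segmentCost_gammaTheta_le hA hB hBu x₀ i).trans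
    (ENNReal.ofReal_le_ofReal (segmentValue_le x₀ (hBu i)))

theorem cost_gammaTheta_le_of_isDeadbeatOnNonsinks (hA : A ∈ structuredMatrices n GP)
    (hB : ∀ i j, i ≠ j → block B i j = 0) (hBu : ∀ i, IsUnit (block B i i))
    (hK : IsDeadbeatOnNonsinks GP A B K) (x₀ : StateIdx n → ℝ) :
    cost A B x₀ (gammaTheta n GP A B) ≤ cost A B x₀ K := by
  rw [cost_eq_sum_segmentCost, cost_eq_sum_segmentCost]
  exact Finset.sum_le_sum fun i _ => (segmentCost_gammaTheta_le hA hB hBu x₀ i).trans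
    (le_segmentCost_of_isDeadbeatOnNonsinks hA hB hBu hK x₀ i)

/-! ### Adversarial plants force deadbeat control of nonsinks -/

/-- The state matrix with the block row `i` of `A`, the entry `r` at `(p, s)`, and zeros
elsewhere. -/
def isolateRow (A : SysMatrix n) (i : Fin q) (p s : StateIdx n) (r : ℝ) : SysMatrix n :=
  Matrix.of fun p' s' => if p'.1 = i then A p' s' else if p' = p ∧ s' = s then r else 0

theorem isolateRow_mem (hA : A ∈ structuredMatrices n GP) (i : Fin q) {p s : StateIdx n}
    (h : GP.Adj s.1 p.1) (r : ℝ) : isolateRow A i p s r ∈ structuredMatrices n GP := by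
  intro j k hjk
  ext a c
  change (if j = i then A ⟨j, a⟩ ⟨k, c⟩ else
    if (⟨j, a⟩ : StateIdx n) = p ∧ (⟨k, c⟩ : StateIdx n) = s then r else 0) = 0
  split_ifs with h1 h2
  · exact congrFun₂ (hA j k hjk) a c
  · obtain ⟨rfl, rfl⟩ := h2
    exact absurd h hjk
  · rfl

theorem blockRow_isolateRow (i : Fin q) (p s : StateIdx n) (r : ℝ) :
    blockRow (isolateRow A i p s r) i = blockRow A i := by
  ext a t
  simp [blockRow, isolateRow]

theorem isolateRow_mulVec_apply {i : Fin q} {p : StateIdx n} (s : StateIdx n) (r : ℝ)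
    (x : StateIdx n → ℝ) {t : StateIdx n} (ht : t.1 ≠ i) :
    (isolateRow A i p s r *ᵥ x) t = if t = p then r * x s else 0 := by
  rw [Matrix.mulVec, dotProduct]
  split_ifs with h
  · rw [Finset.sum_eq_single s]
    · simp [isolateRow, h, h ▸ ht]
    · intro s' _ hs'
      simp [isolateRow, ht, hs']
    · simp
  · refine Finset.sum_eq_zero fun s' _ => ?_
    simp [isolateRow, ht, h]

/-- The right side is quadratic in `v`, least at `v = -b s / (1 + b ^ 2)`. -/
theorem sq_div_one_add_sq_le (s b v : ℝ) : s ^ 2 / (1 + b ^ 2) ≤ (s + b * v) ^ 2 + v ^ 2 := by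
  rw [div_le_iff₀ (by positivity)]
  nlinarith [sq_nonneg ((1 + b ^ 2) * v + b * s)]

/-- Cost forced on subsystem `l` in two steps by a drift entering its coordinate `c`. -/
theorem le_cost_of_drift (hB : ∀ i j, i ≠ j → block B i j = 0) {l : Fin q} {b : ℝ}
    (hBl : block B l l = b • 1) (c : Fin (n l)) (s : StateIdx n) (r : ℝ)
    (hA : ∀ x, (A *ᵥ x) ⟨l, c⟩ = r * x s) (x₀ : StateIdx n → ℝ) :
    ENNReal.ofReal (r ^ 2 * (x₀ s ^ 2 + trajectory A B K x₀ 1 s ^ 2) / (1 + b ^ 2)) ≤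
      cost A B x₀ K := by
  have hstep : ∀ k, ENNReal.ofReal (r ^ 2 * trajectory A B K x₀ k s ^ 2 / (1 + b ^ 2)) ≤
      ENNReal.ofReal (segment (trajectory A B K x₀ (k + 1)) l ⬝ᵥ
        segment (trajectory A B K x₀ (k + 1)) l +
      segment (K *ᵥ trajectory A B K x₀ k) l ⬝ᵥ segment (K *ᵥ trajectory A B K x₀ k) l) := by
    intro k
    have hcoord : ∀ v : Fin (n l) → ℝ, v c ^ 2 ≤ v ⬝ᵥ v := fun v => by
      rw [sq]
      exact Finset.single_le_sum (f := fun j => v j * v j)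
        (fun j _ => mul_self_nonneg _) (Finset.mem_univ c)
    refine ENNReal.ofReal_le_ofReal (le_trans ?_ (add_le_add (hcoord _) (hcoord _)))
    rw [segment_trajectory_succ hB, hBl, Matrix.smul_mulVec, Matrix.one_mulVec, Pi.add_apply,
      Pi.smul_apply, smul_eq_mul, ← mul_pow]
    change (r * _) ^ 2 / _ ≤ ((A *ᵥ trajectory A B K x₀ k) ⟨l, c⟩ + _) ^ 2 + _
    rw [hA]
    exact sq_div_one_add_sq_le _ _ _
  rw [cost_eq_sum_segmentCost]
  refine le_trans ?_ (Finset.single_le_sum (f := fun i => segmentCost A B x₀ K i)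
    (fun _ _ => zero_le) (Finset.mem_univ l))
  -- Only the terms `k = 0, 1` are kept: they carry the drifts caused by `x₀ s` and by the state at
  -- time 1.
  refine le_trans ?_ (ENNReal.sum_le_tsum (Finset.range 2))
  rw [Finset.sum_range_succ, Finset.sum_range_one, mul_add, add_div, ENNReal.ofReal_add
    (by positivity) (by positivity)]
  exact add_le_add (hstep 0) (hstep 1)

/-- Here `α` is the initial value of a coordinate and `β` its residual after one step. The
coefficient of `r ^ 2` on the right exceeds that on the left exactly when `b ^ 2 * β ^ 2 > α ^ 2`;
then `r` can absorb `C`. -/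
theorem exists_gain_violating_bound {α β ε C : ℝ} (hβ : β ≠ 0) (hε : 0 < ε) (hC : 0 ≤ C) :
    ∃ b, ε ≤ b ∧ ∃ r : ℝ, C + (r * α / b) ^ 2 < r ^ 2 * (α ^ 2 + β ^ 2) / (1 + b ^ 2) := by
  have hβ' : 0 < |β| := abs_pos.2 hβ
  -- This gives `b * |β| > |α|` together with `b ≥ ε`.
  set b := ε + |α| / |β| with hb
  have hb0 : 0 < b := by positivity
  have hδ : 0 < b ^ 2 * β ^ 2 - α ^ 2 := by
    have h1 : b * |β| = ε * |β| + |α| := by rw [hb]; field_simp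
    have h2 : |α| < b * |β| := by rw [h1]; linarith [mul_pos hε hβ']
    have h3 := pow_lt_pow_left₀ h2 (abs_nonneg α) two_ne_zero
    rw [mul_pow, sq_abs, sq_abs] at h3
    linarith
  refine ⟨b, le_add_of_nonneg_right (by positivity),
    -- Chosen so that the two sides differ by exactly 1.
    √((C + 1) * (b ^ 2 * (1 + b ^ 2)) / (b ^ 2 * β ^ 2 - α ^ 2)), ?_⟩
  rw [div_pow, mul_pow, Real.sq_sqrt (by positivity)]
  generalize hd : b ^ 2 * β ^ 2 - α ^ 2 = δ at *
  have hβ2 : β ^ 2 = (δ + α ^ 2) / b ^ 2 := by rw [← hd]; field_simp; ring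
  rw [hβ2, ← sub_pos]
  have : (C + 1) * (b ^ 2 * (1 + b ^ 2)) / δ * (α ^ 2 + (δ + α ^ 2) / b ^ 2) / (1 + b ^ 2) -
      (C + (C + 1) * (b ^ 2 * (1 + b ^ 2)) / δ * α ^ 2 / b ^ 2) = 1 := by
    field_simp
    ring
  rw [this]
  exact one_pos

/-- A design method that is never worse than `gammaTheta` cancels the drift of every nonsink. -/
theorem isDeadbeatOnNonsinks_of_cost_le (hn : ∀ i, 1 ≤ n i) {𝓑 : Set (SysMatrix n)}
    (h𝓑 : IsInputClass 𝓑) {Γ : SysMatrix n → SysMatrix n → SysMatrix n}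
    (hΓ : Γ ∈ designMethods n GP GK (selfLoopGraph q) 𝓑)
    (hle : ∀ A ∈ structuredMatrices n GP, ∀ B ∈ 𝓑, ∀ x₀ : StateIdx n → ℝ,
      cost A B x₀ (Γ A B) ≤ cost A B x₀ (gammaTheta n GP A B))
    (hA : A ∈ structuredMatrices n GP) (hB : B ∈ 𝓑) :
    IsDeadbeatOnNonsinks GP A B (Γ A B) := by
  intro i hi x₀
  have hBi := (Matrix.isUnit_iff_isUnit_det _).1 (h𝓑.isUnit B hB i)
  suffices hz : segment (A *ᵥ x₀) i + block B i i *ᵥ segment (Γ A B *ᵥ x₀) i = 0 by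
    rw [eq_neg_of_add_eq_zero_left hz, Matrix.mulVec_neg, neg_neg, Matrix.mulVec_mulVec,
      Matrix.nonsing_inv_mul _ hBi, Matrix.one_mulVec]
  by_contra hz
  obtain ⟨a, ha⟩ := Function.ne_iff.1 hz
  -- The residual at coordinate `a` is propagated along an edge to another node `l`.
  obtain ⟨l, hli, hil⟩ : ∃ l, l ≠ i ∧ GP.Adj i l := by simpa [IsSink] using hi
  obtain ⟨ε, hε, hrep⟩ := h𝓑.replace
  obtain ⟨b, hb, r, hr⟩ := exists_gain_violating_bound (α := x₀ ⟨i, a⟩) ha hε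
    (dotProduct_self_nonneg' ((block B i i)⁻¹ *ᵥ segment (A *ᵥ x₀) i))
  have hb0 : 0 < b := hε.trans_le hb
  let c : Fin (n l) := ⟨0, hn l⟩
  set A' := isolateRow A i ⟨l, c⟩ ⟨i, a⟩ r with hA'def
  set B' := replaceInputBlock B l b with hB'def
  have hA' : A' ∈ structuredMatrices n GP := isolateRow_mem hA i hil r
  have hB' : B' ∈ 𝓑 := hrep B hB l b hb
  have hrow : blockRow A' i = blockRow A i := blockRow_isolateRow _ _ _ _
  have hBi' : block B' i i = block B i i := block_replaceInputBlock_of_ne B hli.symm b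
  have hBl' : block B' l l = b • 1 := block_replaceInputBlock_same B l b
  -- Node `i` cannot tell the modified plant from the original, so it leaves the same residual.
  have hΓrow : blockRow (Γ A' B') i = blockRow (Γ A B) i := by
    refine hΓ.2 i A' hA' A hA B' hB' B hB ?_
    rintro j rfl
    exact ⟨hrow, hBi'⟩
  have hx1 : segment (trajectory A' B' (Γ A' B') x₀ 1) i =
      segment (A *ᵥ x₀) i + block B i i *ᵥ segment (Γ A B *ᵥ x₀) i := by
    rw [segment_trajectory_succ (h𝓑.blockDiag B' hB'), trajectory, hBi', segment_mulVec,
      segment_mulVec, hrow, hΓrow]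
    rfl
  have hlow := le_cost_of_drift (K := Γ A' B') (h𝓑.blockDiag B' hB') hBl' c ⟨i, a⟩ r
    (A := A') (fun x => by rw [hA'def, isolateRow_mulVec_apply _ _ _ hli, if_pos rfl]) x₀
  have hupp : cost A' B' x₀ (gammaTheta n GP A' B') ≤
      ENNReal.ofReal (((block B i i)⁻¹ *ᵥ segment (A *ᵥ x₀) i) ⬝ᵥ
        ((block B i i)⁻¹ *ᵥ segment (A *ᵥ x₀) i) + (r * x₀ ⟨i, a⟩ / b) ^ 2) := by
    refine (cost_gammaTheta_le hA' (h𝓑.blockDiag B' hB') (h𝓑.isUnit B' hB') x₀).trans ?_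
    -- Only `i` and `l` have a nonzero first drift in the modified plant.
    rw [← Finset.sum_subset (Finset.subset_univ {i, l}), Finset.sum_pair hli.symm,
      ENNReal.ofReal_add (dotProduct_self_nonneg' _) (sq_nonneg _), hBi', hBl']
    · refine add_le_add (le_of_eq ?_) (le_of_eq ?_)
      · rw [segment_mulVec, hrow]
        rfl
      · have hseg : segment (A' *ᵥ x₀) l = Pi.single c (r * x₀ ⟨i, a⟩) := by
          ext d
          change (A' *ᵥ x₀) ⟨l, d⟩ = _
          rw [hA'def, isolateRow_mulVec_apply _ _ _ hli, Pi.single_apply]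
          simp
        have hinv : (b • (1 : Matrix (Fin (n l)) (Fin (n l)) ℝ))⁻¹ = b⁻¹ • 1 := by
          refine Matrix.inv_eq_left_inv ?_
          rw [smul_mul_smul_comm, one_mul, inv_mul_cancel₀ hb0.ne', one_smul]
        rw [hseg, hinv, Matrix.smul_mulVec, Matrix.one_mulVec]
        simp
        ring_nf
    · intro j _ hj
      simp only [Finset.mem_insert, Finset.mem_singleton, not_or] at hj
      have hseg : segment (A' *ᵥ x₀) j = 0 := by
        ext d
        change (A' *ᵥ x₀) ⟨j, d⟩ = 0
        rw [hA'def, isolateRow_mulVec_apply _ _ _ hj.1, if_neg]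
        exact fun h => hj.2 (congrArg Sigma.fst h)
      simp [hseg]
  have hfin := (hlow.trans (hle A' hA' B' hB' x₀)).trans hupp
  rw [ENNReal.ofReal_le_ofReal_iff (add_nonneg (dotProduct_self_nonneg' _) (sq_nonneg _))] at hfin
  have hx1a : trajectory A' B' (Γ A' B') x₀ 1 ⟨i, a⟩ =
      (segment (A *ᵥ x₀) i + block B i i *ᵥ segment (Γ A B *ᵥ x₀) i) a := congrFun hx1 a
  rw [hx1a] at hfin
  exact absurd hfin hr.not_ge

/-! ### `gammaTheta` is a communication-less design method -/

theorem blockRow_gammaTheta (i : Fin q) :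
    blockRow (gammaTheta n GP A B) i = -((open Classical in
      if IsSink GP i then lqrFactor (block A i i) (block B i i) else (block B i i)⁻¹) *
        blockRow A i) := by
  refine Matrix.ext_of_mulVec_single fun s => ?_
  rw [Matrix.neg_mulVec, ← Matrix.mulVec_mulVec]
  exact segment_gammaTheta_mulVec _ i

theorem gammaTheta_mem_designMethods (hGK : GP ≤ GK) (𝓑 : Set (SysMatrix n)) :
    gammaTheta n GP ∈ designMethods n GP GK (selfLoopGraph q) 𝓑 := by
  refine ⟨fun A hA B _ i j hij => ?_, fun i A _ A' _ B _ B' _ h => ?_⟩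
  · have hblock : block A i j = 0 := hA i j fun h => hij (hGK h)
    ext a c
    change blockRow (gammaTheta n GP A B) i a ⟨j, c⟩ = 0
    rw [blockRow_gammaTheta, Matrix.neg_apply, Matrix.mul_apply, neg_eq_zero]
    exact Finset.sum_eq_zero fun d _ => mul_eq_zero_of_right _ (congrFun₂ hblock d c)
  · obtain ⟨hrow, hB⟩ := h i rfl
    have hA : block A i i = block A' i i := by
      ext a c
      exact congrFun₂ hrow a ⟨i, c⟩
    rw [blockRow_gammaTheta, blockRow_gammaTheta, hrow, hB, hA]

end LimitedModel

end

theorem mainTheorem8 {q : ℕ} (n : Fin q → ℕ) (hn : ∀ i, 1 ≤ n i)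
    (GP GK : Digraph (Fin q)) (ε : ℝ) (hε : 0 < ε)
    (hIsolated : ∀ i, ¬ LimitedModel.IsIsolated GP i)
    (hSink : ∃ i, LimitedModel.IsSink GP i)
    (hGK : GP ≤ GK)
    (𝓑 : Set (LimitedModel.SysMatrix n))
    (h𝓑 : 𝓑 = LimitedModel.inputMatrices n ε ∨ 𝓑 = LimitedModel.diagInputMatrices n ε) :
    (∀ A ∈ LimitedModel.structuredMatrices n GP, ∀ B ∈ 𝓑, ∀ i, LimitedModel.IsSink GP i →
      ∃! X, LimitedModel.IsRiccatiSolution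
        (LimitedModel.block A i i) (LimitedModel.block B i i) X) ∧
    LimitedModel.IsUndominated n GP GK (LimitedModel.selfLoopGraph q) 𝓑
      (LimitedModel.gammaTheta n GP) := by
  obtain ⟨i₀, -⟩ := hSink
  -- A nonempty state space ensures that the index `card - 1` is not truncated and picks the
  -- smallest singular value.
  have : Nonempty (LimitedModel.StateIdx n) := ⟨⟨i₀, 0, hn i₀⟩⟩
  have hclass := LimitedModel.isInputClass_of_eq hε h𝓑
  refine ⟨fun A _ B hB i _ =>
    LimitedModel.existsUnique_isRiccatiSolution _ (hclass.isUnit B hB i),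
    LimitedModel.gammaTheta_mem_designMethods hGK 𝓑, ?_⟩
  rintro Γ hΓ ⟨hle, A, hA, B, hB, x₀, hlt⟩
  exact hlt.not_ge (LimitedModel.cost_gammaTheta_le_of_isDeadbeatOnNonsinks hA
    (hclass.blockDiag B hB) (hclass.isUnit B hB)
    (LimitedModel.isDeadbeatOnNonsinks_of_cost_le hn hclass hΓ hle hA hB) x₀)
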